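/- **Setting.** Let $K\ge 0$ and $d_1,\dots,d_K$ be integers, and let $(X_i,A_i,R_i)$, $i=1,2,\dots$, be i.i.d. copies of $(X,A,R)$, where $X$ is a context with values in a measurable space, $A=(A_1,\dots,A_K)\in\prod_{k=1}^K\{1,\dots,d_k\}$ is a slate with $A\sim\mu(\cdot\mid X)$, and $R$ is a real reward with conditional law $\mathbb P(\cdot\mid A,X)$. The logging policy $\mu$ is factored: $\mu(a\mid x)=\prod_{k=1}^K\mu_k(a_k\mid x)$ with probability distributions $\mu_k(\cdot\mid x)$ on $\{1,\dots,d_k\}$. Let $\pi(\cdot\mid x)$ be a target policy on slates, with slot marginals $\pi(a_k\mid x)$, such that for almost every context $x$ and every $k$, $\pi(a_k\mid x)>0$ implies $\mu_k(a_k\mid x)>0$. Put $$Y_k=\frac{\pi(A_k\mid X)}{\mu_k(A_k\mid X)},\qquad G=1+\sum_{k=1}^K(Y_k-1),\qquad \theta=\mathbb E[GR],$$ and assume $\mathbb E[Y_k^2]<\infty$ for every $k$ and $\mathbb E[(GR)^2]<\infty$. For $\beta\in\mathbb R$ let $$\Gamma_\beta=GR-\beta(G-1),\qquad \hat\theta_n^{(\beta)}=\mathbb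 E_n[\Gamma_\beta],\qquad V_\beta=\operatorname{Var}(\Gamma_\beta),\qquad V^\dagger=\inf_{\beta\in\mathbb R}V_\beta,$$ where $\mathbb E_n[f(X,A,R)]=\frac1n\sum_{i=1}^n f(X_i,A_i,R_i)$. **Claim.** Compute the data-driven weight $$\hat\beta_n^*=\frac{\mathbb E_n[GR(G-1)]}{\sum_{k=1}^K\mathbb E_n[(Y_k-1)^2]}$$ (with $0/0=0$; if the denominator vanishes, then so do the numerator and $\mathbb E_n[G-1]$, and the estimator below does not depend on this convention). Then, as $n\to\infty$, $$\sqrt n\,\bigl(\hat\theta_n^{(\hat\beta_n^*)}-\theta\bigr)\;\to_d\;\mathcal N(0,V^\dagger),$$ where $\mathcal N(0,0)$ is the point mass at $0$. That is, $\hat\theta_n^{(\hat\beta_n^*)}$ attains asymptotically the smallest variance $V^\dagger$ among the estimators $\hat\theta_n^{(\beta)}$ with a fixed single weight $\beta$. -/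

import Mathlib

open MeasureTheory ProbabilityTheory Filter
open scoped Topology

noncomputable section

namespace SlateOPE

/-- Slates with `K` slots; slot `k` has the `d k` available actions `Fin (d k)`. -/
abbrev Slate {K : ℕ} (d : Fin K → ℕ) : Type := (k : Fin K) → Fin (d k)

/-- Observations: a context, a slate and a real reward, grouped as `((x, a), r)`. -/
abbrev Obs (𝒳 : Type*) {K : ℕ} (d : Fin K → ℕ) : Type _ := (𝒳 × Slate d) × ℝ

section Model

variable {𝒳 : Type*} [MeasurableSpace 𝒳] {K : ℕ} {d : Fin K → ℕ}

/-- The law of `(X, A, R)` when `X ∼ PX`, `A ∼ μ(· ∣ X)` and `R ∼ ρ(· ∣ X, A)`. -/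
def dataLaw (PX : Measure 𝒳) (μ : Kernel 𝒳 (Slate d)) (ρ : Kernel (𝒳 × Slate d) ℝ) :
    Measure (Obs 𝒳 d) :=
  (PX ⊗ₘ μ) ⊗ₘ ρ

/-- `π(A_k = j ∣ X = x)`: the probability that the policy `π` plays action `j` in slot `k`. -/
def slotProb (π : Kernel 𝒳 (Slate d)) (k : Fin K) (j : Fin (d k)) (x : 𝒳) : ℝ :=
  (π x).real {a | a k = j}

/-- `μ(a ∣ x) = ∏ k, μ_k(a_k ∣ x)` for (almost) every context `x` and every slate `a`. -/
def IsFactored (PX : Measure 𝒳) (μ : Kernel 𝒳 (Slate d))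
    (μs : (k : Fin K) → Kernel 𝒳 (Fin (d k))) : Prop :=
  ∀ᵐ x ∂PX, ∀ a : Slate d, (μ x).real {a} = ∏ k, (μs k x).real {a k}

/-- Slot-level coverage: in (almost) every context, an action which `π` plays in slot `k` with
positive probability has positive probability under `μ_k`. -/
def Covers (PX : Measure 𝒳) (π : Kernel 𝒳 (Slate d))
    (μs : (k : Fin K) → Kernel 𝒳 (Fin (d k))) : Prop :=
  ∀ᵐ x ∂PX, ∀ k, ∀ j : Fin (d k), 0 < slotProb π k j x → 0 < (μs k x).real {j}

variable (π : Kernel 𝒳 (Slate d)) (μs : (k : Fin K) → Kernel 𝒳 (Fin (d k)))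

/-- The slot-level density ratio `Y_k = π(A_k ∣ X) / μ_k(A_k ∣ X)`. -/
def Y (k : Fin K) (z : Obs 𝒳 d) : ℝ :=
  slotProb π k (z.1.2 k) z.1.1 / (μs k z.1.1).real {z.1.2 k}

/-- `G = 1 + ∑ k, (Y_k - 1)`. -/
def G (z : Obs 𝒳 d) : ℝ := 1 + ∑ k, (Y π μs k z - 1)

/-- `G R`. -/
def GR (z : Obs 𝒳 d) : ℝ := G π μs z * z.2

/-- `Γ_β = G R - β (G - 1)`. -/
def Gam (β : ℝ) (z : Obs 𝒳 d) : ℝ := GR π μs z - β * (G π μs z - 1)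

/-- The target parameter `θ = E[G R]`, for data with law `P`. -/
def theta (P : Measure (Obs 𝒳 d)) : ℝ := ∫ z, GR π μs z ∂P

/-- `V_β = Var(Γ_β)`. -/
def V (P : Measure (Obs 𝒳 d)) (β : ℝ) : ℝ := variance (Gam π μs β) P

/-- `V† = inf_β V_β`, an infimum of nonnegative numbers. -/
def Vdagger (P : Measure (Obs 𝒳 d)) : ℝ := ⨅ β : ℝ, V π μs P β

end Model

section Estimators

variable {𝒳 : Type*} [MeasurableSpace 𝒳] {K : ℕ} {d : Fin K → ℕ}
variable (π : Kernel 𝒳 (Slate d)) (μs : (k : Fin K) → Kernel 𝒳 (Fin (d k)))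

/-- The sample average `E_n[f] = (1 / n) ∑_{i < n} f(z_i)` over the first `n` points of `z`. -/
def En (z : ℕ → Obs 𝒳 d) (n : ℕ) (f : Obs 𝒳 d → ℝ) : ℝ :=
  (1 / (n : ℝ)) * ∑ i ∈ Finset.range n, f (z i)

/-- The single-control-variate estimator `θ̂_n^{(β)} = E_n[Γ_β]`. -/
def thetaHat (z : ℕ → Obs 𝒳 d) (n : ℕ) (β : ℝ) : ℝ := En z n (Gam π μs β)

/-- The data-driven weight `β̂*_n = E_n[G R (G - 1)] / ∑ k, E_n[(Y_k - 1)²]`. If the denominator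
vanishes, then `Y_k = 1` for all `k` on the whole sample, so the numerator and `E_n[G - 1]` vanish
too; the estimator then is `E_n[G R]` whatever value is given to the weight. -/
def betaHat (z : ℕ → Obs 𝒳 d) (n : ℕ) : ℝ :=
  En z n (fun t ↦ GR π μs t * (G π μs t - 1)) / ∑ k, En z n (fun t ↦ (Y π μs k t - 1) ^ 2)

end Estimators

end SlateOPE

end

namespace SlateOPE

section Moments

variable {𝒳 : Type*} [MeasurableSpace 𝒳] {K : ℕ} {d : Fin K → ℕ}
  {PX : Measure 𝒳} [IsProbabilityMeasure PX]
  {μ : Kernel 𝒳 (Slate d)} [IsMarkovKernel μ]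
  {μs : (k : Fin K) → Kernel 𝒳 (Fin (d k))} {π : Kernel 𝒳 (Slate d)}
  {ρ : Kernel (𝒳 × Slate d) ℝ} [IsMarkovKernel ρ]

/-! Given the context, the slots are independent under the factored logging policy, and coverage
gives each `Y_k - 1` conditional mean zero. So `E[G - 1] = 0` and the cross terms of `E[(G - 1)²]`
vanish, leaving `S = ∑ k, E[(Y_k - 1)²]`. Hence `V_β` is quadratic in `β` with leading coefficient
`S`, minimised at `betaStar` (`Vdagger_eq`).

The strong law gives `betaHat → betaStar` almost surely. Replacing one weight by the other changes
the scaled estimator by `-(betaHat - betaStar) · √n E_n[G - 1]`, a null factor times one that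
converges in law, so Slutsky reduces the claim to the central limit theorem at the fixed weight
`betaStar` (`tendstoInDistribution_controlVariate`). -/

instance isProbabilityMeasure_dataLaw : IsProbabilityMeasure (dataLaw PX μ ρ) := by
  unfold dataLaw; infer_instance

theorem memLp_Y_sub_one (hY : ∀ k, MemLp (Y π μs k) 2 (dataLaw PX μ ρ)) (k : Fin K) :
    MemLp (fun z ↦ Y π μs k z - 1) 2 (dataLaw PX μ ρ) :=
  (hY k).sub (memLp_const 1)

theorem G_sub_one (z : Obs 𝒳 d) : G π μs z - 1 = ∑ k, (Y π μs k z - 1) := by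
  simp [G]

theorem memLp_G_sub_one (hY : ∀ k, MemLp (Y π μs k) 2 (dataLaw PX μ ρ)) :
    MemLp (fun z ↦ G π μs z - 1) 2 (dataLaw PX μ ρ) := by
  simp_rw [G_sub_one]
  exact memLp_finsetSum _ fun k _ ↦ memLp_Y_sub_one hY k

variable [∀ k, IsMarkovKernel (μs k)] [IsMarkovKernel π]

theorem sum_slotProb (k : Fin K) (x : 𝒳) : ∑ j, slotProb π k j x = 1 := by
  have h : ∀ j, slotProb π k j x = ((π x).map (fun a ↦ a k)).real {j} := fun j ↦ by
    rw [map_measureReal_apply (measurable_pi_apply k) (measurableSet_singleton j)]; rfl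
  have : IsProbabilityMeasure ((π x).map (fun a ↦ a k)) :=
    Measure.isProbabilityMeasure_map (measurable_pi_apply k).aemeasurable
  simp_rw [h]
  rw [sum_measureReal_singleton]
  simp

/-- Under a covered slot distribution the density ratio has mean one. -/
theorem sum_mul_ratio_sub_one {x : 𝒳} {k : Fin K}
    (h : ∀ j, 0 < slotProb π k j x → 0 < (μs k x).real {j}) :
    ∑ j, (μs k x).real {j} * (slotProb π k j x / (μs k x).real {j} - 1) = 0 := by
  have h1 : ∀ j, (μs k x).real {j} * (slotProb π k j x / (μs k x).real {j} - 1)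
      = slotProb π k j x - (μs k x).real {j} := fun j ↦ by
    -- Where `μ_k` vanishes, coverage makes the numerator vanish too, so the convention `0 / 0 = 0`
    -- loses no mass.
    by_cases hj : (μs k x).real {j} = 0
    · have : slotProb π k j x = 0 := by
        by_contra hne
        exact (h j (lt_of_le_of_ne measureReal_nonneg (Ne.symm hne))).ne' hj
      simp [hj, this]
    · field_simp
  simp_rw [h1]
  rw [Finset.sum_sub_distrib, sum_slotProb, sum_measureReal_singleton]
  simp

/-- Centred density ratios of distinct slots are conditionally uncorrelated and centred: products
over nonempty sets of slots have mean zero. -/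
theorem integral_prod_Y_sub_one (hfact : IsFactored PX μ μs) (hcov : Covers PX π μs)
    {S : Finset (Fin K)} (hS : S.Nonempty)
    (hint : Integrable (fun z ↦ ∏ k ∈ S, (Y π μs k z - 1)) (dataLaw PX μ ρ)) :
    ∫ z, ∏ k ∈ S, (Y π μs k z - 1) ∂(dataLaw PX μ ρ) = 0 := by
  obtain ⟨k₀, hk₀⟩ := hS
  have hsm : Integrable (fun p : 𝒳 × Slate d ↦
      ∏ k ∈ S, (slotProb π k (p.2 k) p.1 / (μs k p.1).real {p.2 k} - 1)) (PX ⊗ₘ μ) := by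
    have h : Integrable (fun p : 𝒳 × Slate d ↦ ∫ r, ∏ k ∈ S, (Y π μs k (p, r) - 1) ∂(ρ p))
        (PX ⊗ₘ μ) := by
      rw [dataLaw, Measure.compProd] at hint
      simpa using hint.integral_compProd
    simpa [Y] using h
  unfold dataLaw at hint ⊢
  rw [Measure.integral_compProd hint]
  simp only [Y, integral_const, probReal_univ, one_smul]
  rw [Measure.integral_compProd hsm, integral_eq_zero_of_ae]
  filter_upwards [hfact, hcov] with x hx hc
  rw [integral_fintype Integrable.of_finite]
  simp only [smul_eq_mul, hx, Pi.zero_apply]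
  -- Padding with factors 1 outside `S` makes the summand a product over all slots; the sum over
  -- slates then factorises slot by slot, and the factor at `k₀` is zero.
  have hprod : ∀ a : Slate d, (∏ k, (μs k x).real {a k}) *
      ∏ k ∈ S, (slotProb π k (a k) x / (μs k x).real {a k} - 1)
      = ∏ k, (μs k x).real {a k} *
        (if k ∈ S then slotProb π k (a k) x / (μs k x).real {a k} - 1 else 1) := fun a ↦ by
    rw [Finset.prod_mul_distrib, Finset.prod_ite_mem, Finset.univ_inter]
  simp_rw [hprod]
  rw [← Fintype.piFinset_univ, ← Finset.prod_univ_sum (fun _ ↦ Finset.univ)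
      (fun k j ↦ (μs k x).real {j} *
        (if k ∈ S then slotProb π k j x / (μs k x).real {j} - 1 else 1))]
  refine Finset.prod_eq_zero (Finset.mem_univ k₀) ?_
  simpa [hk₀] using sum_mul_ratio_sub_one (hc k₀)

theorem integral_Y_sub_one (hfact : IsFactored PX μ μs) (hcov : Covers PX π μs)
    (hY : ∀ k, MemLp (Y π μs k) 2 (dataLaw PX μ ρ)) (k : Fin K) :
    ∫ z, (Y π μs k z - 1) ∂(dataLaw PX μ ρ) = 0 := by
  simpa using integral_prod_Y_sub_one hfact hcov (Finset.singleton_nonempty k)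
    (by simpa using (memLp_Y_sub_one hY k).integrable one_le_two)

theorem integral_Y_sub_one_mul (hfact : IsFactored PX μ μs) (hcov : Covers PX π μs)
    (hY : ∀ k, MemLp (Y π μs k) 2 (dataLaw PX μ ρ)) {k l : Fin K} (hkl : k ≠ l) :
    ∫ z, (Y π μs k z - 1) * (Y π μs l z - 1) ∂(dataLaw PX μ ρ) = 0 := by
  simpa [Finset.prod_pair hkl] using integral_prod_Y_sub_one hfact hcov (S := {k, l}) (by simp)
    (by simp_rw [Finset.prod_pair hkl]
        exact (memLp_Y_sub_one hY k).integrable_mul (memLp_Y_sub_one hY l))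

theorem integral_G_sub_one (hfact : IsFactored PX μ μs) (hcov : Covers PX π μs)
    (hY : ∀ k, MemLp (Y π μs k) 2 (dataLaw PX μ ρ)) :
    ∫ z, (G π μs z - 1) ∂(dataLaw PX μ ρ) = 0 := by
  simp_rw [G_sub_one]
  rw [integral_finsetSum _ fun k _ ↦ (memLp_Y_sub_one hY k).integrable one_le_two]
  exact Finset.sum_eq_zero fun k _ ↦ integral_Y_sub_one hfact hcov hY k

/-- Orthogonality of distinct slots is what justifies the denominator of `betaHat`, which omits the
cross terms. -/
theorem integral_G_sub_one_sq (hfact : IsFactored PX μ μs) (hcov : Covers PX π μs)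
    (hY : ∀ k, MemLp (Y π μs k) 2 (dataLaw PX μ ρ)) :
    ∫ z, (G π μs z - 1) ^ 2 ∂(dataLaw PX μ ρ)
      = ∑ k, ∫ z, (Y π μs k z - 1) ^ 2 ∂(dataLaw PX μ ρ) := by
  have hmul : ∀ k l, Integrable (fun z ↦ (Y π μs k z - 1) * (Y π μs l z - 1)) (dataLaw PX μ ρ) :=
    fun k l ↦ (memLp_Y_sub_one hY k).integrable_mul (memLp_Y_sub_one hY l)
  simp_rw [G_sub_one, sq, Finset.sum_mul_sum]
  rw [integral_finsetSum _ fun k _ ↦ integrable_finsetSum _ fun l _ ↦ hmul k l]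
  refine Finset.sum_congr rfl fun k _ ↦ ?_
  rw [integral_finsetSum _ fun l _ ↦ hmul k l]
  exact Finset.sum_eq_single k
    (fun l _ hl ↦ integral_Y_sub_one_mul hfact hcov hY (Ne.symm hl)) (by simp)

end Moments

/-- Convergence in distribution to zero implies convergence in probability to zero. -/
theorem tendstoInMeasure_zero_of_tendstoInDistribution {Ω Ω' : Type*} [MeasurableSpace Ω]
    [MeasurableSpace Ω'] {P : Measure Ω} [IsProbabilityMeasure P] {P' : Measure Ω'}
    [IsProbabilityMeasure P'] {X : ℕ → Ω → ℝ}
    (h : TendstoInDistribution X atTop (fun _ ↦ (0 : ℝ)) (fun _ ↦ P) P') :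
    TendstoInMeasure P X atTop 0 := by
  rw [tendstoInMeasure_iff_norm]
  intro ε hε
  have hmeas : MeasurableSet {x : ℝ | ε ≤ ‖x‖} :=
    (isClosed_le continuous_const continuous_norm).measurableSet
  have hclosed : IsClosed {x : ℝ | ε ≤ ‖x‖} := isClosed_le continuous_const continuous_norm
  -- Portmanteau: the closed set `ε ≤ ‖x‖` has no mass under the limit law, the point mass at zero.
  have hlim := ProbabilityMeasure.limsup_measure_closed_le_of_tendsto h.tendsto hclosed
  simp only [ProbabilityMeasure.coe_mk] at hlim
  rw [Measure.map_const] at hlim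
  simp only [measure_univ, one_smul, Measure.dirac_apply' _ hmeas] at hlim
  rw [Set.indicator_of_notMem (by simpa using hε)] at hlim
  have h0 : Tendsto (fun n ↦ P.map (X n) {x : ℝ | ε ≤ ‖x‖}) atTop (𝓝 0) :=
    tendsto_of_le_liminf_of_limsup_le (zero_le) hlim
  refine h0.congr fun n ↦ ?_
  rw [Measure.map_apply_of_aemeasurable (h.forall_aemeasurable n) hmeas]
  simp

/-! ### Limit theorems for i.i.d. sample averages -/

section Sampling

variable {𝒵 Ω : Type*} [MeasurableSpace 𝒵] [MeasurableSpace Ω] {D : Measure 𝒵}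
  {P : Measure Ω} {Z : ℕ → Ω → 𝒵}

theorem ae_tendsto_average (hlaw : ∀ i, HasLaw (Z i) D P) (hindep : iIndepFun Z P)
    {f : 𝒵 → ℝ} (hf : Integrable f D) :
    ∀ᵐ ω ∂P, Tendsto (fun n : ℕ ↦ (1 / (n : ℝ)) * ∑ i ∈ Finset.range n, f (Z i ω)) atTop
      (𝓝 (∫ z, f z ∂D)) := by
  have hfm : ∀ i, AEMeasurable f (P.map (Z i)) := fun i ↦ by
    rw [(hlaw i).map_eq]; exact hf.aemeasurable
  have hind : iIndepFun (fun i ↦ f ∘ Z i) P :=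
    hindep.comp₀ (fun _ ↦ f) (fun i ↦ (hlaw i).aemeasurable) hfm
  have hid : ∀ i, IdentDistrib (f ∘ Z i) (f ∘ Z 0) P P := fun i ↦
    ((hlaw i).identDistrib (hlaw 0)).comp_of_aemeasurable (hfm i)
  have hint : Integrable (f ∘ Z 0) P := by
    rw [← (hlaw 0).map_eq] at hf
    exact hf.comp_aemeasurable (hlaw 0).aemeasurable
  have := strong_law_ae_real (fun i ↦ f ∘ Z i) hint (fun i j hij ↦ hind.indepFun hij) hid
  rw [(hlaw 0).integral_comp hf.aestronglyMeasurable] at this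
  filter_upwards [this] with ω hω
  refine hω.congr fun n ↦ ?_
  simp [div_eq_inv_mul]

theorem ae_forall_sample (hlaw : ∀ i, HasLaw (Z i) D P) {p : 𝒵 → Prop} (hp : ∀ᵐ z ∂D, p z) :
    ∀ᵐ ω ∂P, ∀ i, p (Z i ω) := by
  refine ae_all_iff.2 fun i ↦ ?_
  rw [← (hlaw i).map_eq] at hp
  exact ae_of_ae_map (hlaw i).aemeasurable hp

variable [IsProbabilityMeasure P]

/-- The central limit theorem for sample averages of a square-integrable function. -/
theorem tendstoInDistribution_sqrt_mul_average (hlaw : ∀ i, HasLaw (Z i) D P)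
    (hindep : iIndepFun Z P) {f : 𝒵 → ℝ} (hf : MemLp f 2 D) :
    TendstoInDistribution
      (fun (n : ℕ) ω ↦ √(n : ℝ) * ((1 / (n : ℝ)) * ∑ i ∈ Finset.range n, f (Z i ω) - ∫ z, f z ∂D))
      atTop (id : ℝ → ℝ) (fun _ ↦ P) (gaussianReal 0 (variance f D).toNNReal) := by
  have hfm : ∀ i, AEMeasurable f (P.map (Z i)) := fun i ↦ by
    rw [(hlaw i).map_eq]; exact hf.aemeasurable
  have hind : iIndepFun (fun i ↦ f ∘ Z i) P :=
    hindep.comp₀ (fun _ ↦ f) (fun i ↦ (hlaw i).aemeasurable) hfm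
  have hid : ∀ i, IdentDistrib (f ∘ Z i) (f ∘ Z 0) P P := fun i ↦
    ((hlaw i).identDistrib (hlaw 0)).comp_of_aemeasurable (hfm i)
  have hL : MemLp (f ∘ Z 0) 2 P := by
    have hf' := hf
    rw [← (hlaw 0).map_eq] at hf'
    exact hf'.comp_of_map (hlaw 0).aemeasurable
  have hvar : Var[f ∘ Z 0; P] = Var[f; D] := by
    rw [← variance_map (hfm 0) (hlaw 0).aemeasurable, (hlaw 0).map_eq]
  have := tendstoInDistribution_inv_sqrt_mul_sum_sub (X := fun i ↦ f ∘ Z i)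
    (Y := (id : ℝ → ℝ)) (P' := gaussianReal 0 (variance f D).toNNReal)
    (by rw [hvar]; exact HasLaw.id) hL hind hid
  rw [(hlaw 0).integral_comp hf.aestronglyMeasurable] at this
  refine this.congr (fun n ↦ ae_of_all _ fun ω ↦ ?_) (ae_of_all _ fun _ ↦ rfl)
  rcases Nat.eq_zero_or_pos n with rfl | hn
  · simp
  · have hn' : (0 : ℝ) < n := by exact_mod_cast hn
    have hs : √(n : ℝ) ≠ 0 := (Real.sqrt_pos.2 hn').ne'
    have hsq : √(n : ℝ) * √(n : ℝ) = n := Real.mul_self_sqrt hn'.le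
    simp only [Function.comp_apply]
    rw [inv_mul_eq_iff_eq_mul₀ hs, ← mul_assoc, hsq]
    field_simp

variable [IsProbabilityMeasure D]

/-- A control variate with an estimated weight has the same asymptotic law as with the limiting
weight. -/
theorem tendstoInDistribution_controlVariate (hlaw : ∀ i, HasLaw (Z i) D P)
    (hindep : iIndepFun Z P) {f w : 𝒵 → ℝ} (hf : MemLp f 2 D) (hw : MemLp w 2 D)
    (hw0 : ∫ z, w z ∂D = 0) {b : ℕ → Ω → ℝ} (hb : ∀ n, AEMeasurable (b n) P) {β : ℝ}
    (hbβ : ∀ᵐ ω ∂P, Tendsto (fun n ↦ b n ω) atTop (𝓝 β)) :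
    TendstoInDistribution
      (fun (n : ℕ) ω ↦ √(n : ℝ) *
        ((1 / (n : ℝ)) * ∑ i ∈ Finset.range n, (f (Z i ω) - b n ω * w (Z i ω)) - ∫ z, f z ∂D))
      atTop (id : ℝ → ℝ) (fun _ ↦ P)
      (gaussianReal 0 (variance (fun z ↦ f z - β * w z) D).toNNReal) := by
  have hfZ : ∀ i, AEMeasurable (fun ω ↦ f (Z i ω)) P := fun i ↦
    AEMeasurable.comp_aemeasurable (by rw [(hlaw i).map_eq]; exact hf.aemeasurable)
      (hlaw i).aemeasurable
  have hwZ : ∀ i, AEMeasurable (fun ω ↦ w (Z i ω)) P := fun i ↦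
    AEMeasurable.comp_aemeasurable (by rw [(hlaw i).map_eq]; exact hw.aemeasurable)
      (hlaw i).aemeasurable
  have hmean : ∫ z, (f z - β * w z) ∂D = ∫ z, f z ∂D := by
    rw [integral_sub (hf.integrable one_le_two) ((hw.integrable one_le_two).const_mul β),
      integral_const_mul, hw0]
    simp
  have hmain := tendstoInDistribution_sqrt_mul_average hlaw hindep (hf.sub (hw.const_mul β))
  have hW := tendstoInDistribution_sqrt_mul_average hlaw hindep hw
  have hdiff : TendstoInMeasure P (fun n ω ↦ b n ω - β) atTop (fun _ ↦ (0 : ℝ)) := by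
    refine tendstoInMeasure_of_tendsto_ae
      (fun n ↦ ((hb n).sub_const β).aestronglyMeasurable) ?_
    filter_upwards [hbβ] with ω hω
    simpa using hω.sub_const β
  -- Slutsky: `b n` may depend on the same sample, since only its convergence in probability is
  -- used.
  have hprod := hW.continuous_comp_prodMk_of_tendstoInMeasure_const
    (g := fun p : ℝ × ℝ ↦ -(p.1 * p.2)) (by fun_prop) hdiff (fun n ↦ (hb n).sub_const β)
  simp only [mul_zero, neg_zero] at hprod
  refine tendstoInDistribution_of_tendstoInMeasure_sub _ _ hmain ?_ fun n ↦ ?_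
  · convert tendstoInMeasure_zero_of_tendstoInDistribution hprod using 1
    funext n ω
    simp only [Pi.sub_apply, hmean, hw0, Finset.sum_sub_distrib, ← Finset.mul_sum]
    ring
  · refine (((Finset.aemeasurable_fun_sum _ fun i _ ↦
      (hfZ i).sub ((hb n).mul (hwZ i))).const_mul _).sub_const _).const_mul _

end Sampling

/-! ### Consistency and optimality of the weight -/

section Weight

variable {𝒳 : Type*} [MeasurableSpace 𝒳] {K : ℕ} {d : Fin K → ℕ}
  {μs : (k : Fin K) → Kernel 𝒳 (Fin (d k))} {π : Kernel 𝒳 (Slate d)}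

/-- The population weight `E[G R (G - 1)] / ∑ k, E[(Y_k - 1)²]`, zero if the denominator vanishes. -/
noncomputable def betaStar (π : Kernel 𝒳 (Slate d)) (μs : (k : Fin K) → Kernel 𝒳 (Fin (d k)))
    (D : Measure (Obs 𝒳 d)) : ℝ :=
  (∫ z, GR π μs z * (G π μs z - 1) ∂D) / ∑ k, ∫ z, (Y π μs k z - 1) ^ 2 ∂D

/-- If the total variance of the density ratios vanishes, every ratio is almost surely one. -/
theorem ae_Y_eq_one {D : Measure (Obs 𝒳 d)} [IsProbabilityMeasure D]
    (hY : ∀ k, MemLp (Y π μs k) 2 D)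
    (h0 : ∑ k, ∫ z, (Y π μs k z - 1) ^ 2 ∂D = 0) : ∀ᵐ z ∂D, ∀ k, Y π μs k z = 1 := by
  refine ae_all_iff.2 fun k ↦ ?_
  have hk := (Finset.sum_eq_zero_iff_of_nonneg fun k _ ↦
    integral_nonneg fun z ↦ sq_nonneg (Y π μs k z - 1)).1 h0 k (Finset.mem_univ k)
  have hL : MemLp (fun z ↦ Y π μs k z - 1) 2 D := (hY k).sub (memLp_const 1)
  rw [integral_eq_zero_iff_of_nonneg (fun z ↦ sq_nonneg _) hL.integrable_sq] at hk
  filter_upwards [hk] with z hz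
  simpa [sub_eq_zero] using hz

/-- The estimated weight is strongly consistent, also in the degenerate case. -/
theorem ae_tendsto_betaHat {D : Measure (Obs 𝒳 d)} [IsProbabilityMeasure D]
    (hY : ∀ k, MemLp (Y π μs k) 2 D) (hGR : MemLp (GR π μs) 2 D)
    (hG : MemLp (fun z ↦ G π μs z - 1) 2 D)
    {Ω : Type*} [MeasurableSpace Ω] {P : Measure Ω} [IsProbabilityMeasure P]
    {Z : ℕ → Ω → Obs 𝒳 d} (hlaw : ∀ i, HasLaw (Z i) D P) (hindep : iIndepFun Z P) :
    ∀ᵐ ω ∂P, Tendsto (fun n ↦ betaHat π μs (fun i ↦ Z i ω) n) atTop (𝓝 (betaStar π μs D)) := by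
  by_cases h0 : ∑ k, ∫ z, (Y π μs k z - 1) ^ 2 ∂D = 0
  -- Almost surely every sampled ratio is one, so both weights are zero by the convention for
  -- division by zero.
  · filter_upwards [ae_forall_sample hlaw (ae_Y_eq_one hY h0)] with ω hω
    simp [betaHat, betaStar, En, h0, hω]
  · have hnum := ae_tendsto_average hlaw hindep
      (f := fun z ↦ GR π μs z * (G π μs z - 1)) (hGR.integrable_mul hG)
    have hden : ∀ᵐ ω ∂P, ∀ k, Tendsto (fun n ↦ En (fun i ↦ Z i ω) n fun t ↦ (Y π μs k t - 1) ^ 2)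
        atTop (𝓝 (∫ z, (Y π μs k z - 1) ^ 2 ∂D)) := ae_all_iff.2 fun k ↦
      ae_tendsto_average hlaw hindep (f := fun z ↦ (Y π μs k z - 1) ^ 2)
        ((hY k).sub (memLp_const 1)).integrable_sq
    filter_upwards [hnum, hden] with ω hω hω'
    exact hω.div (tendsto_finsetSum _ fun k _ ↦ hω' k) h0

theorem aemeasurable_En {D : Measure (Obs 𝒳 d)} {Ω : Type*} [MeasurableSpace Ω] {P : Measure Ω}
    {Z : ℕ → Ω → Obs 𝒳 d} (hlaw : ∀ i, HasLaw (Z i) D P) {f : Obs 𝒳 d → ℝ}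
    (hf : AEMeasurable f D) (n : ℕ) : AEMeasurable (fun ω ↦ En (fun i ↦ Z i ω) n f) P :=
  (Finset.aemeasurable_fun_sum _ fun i _ ↦ AEMeasurable.comp_aemeasurable
    (by rwa [(hlaw i).map_eq]) (hlaw i).aemeasurable).const_mul _

theorem aemeasurable_betaHat {D : Measure (Obs 𝒳 d)}
    (hY : ∀ k, AEMeasurable (Y π μs k) D) (hGR : AEMeasurable (GR π μs) D)
    (hG : AEMeasurable (fun z ↦ G π μs z - 1) D)
    {Ω : Type*} [MeasurableSpace Ω] {P : Measure Ω}
    {Z : ℕ → Ω → Obs 𝒳 d} (hlaw : ∀ i, HasLaw (Z i) D P) (n : ℕ) :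
    AEMeasurable (fun ω ↦ betaHat π μs (fun i ↦ Z i ω) n) P :=
  (aemeasurable_En hlaw (hGR.mul hG) n).div
    (Finset.aemeasurable_fun_sum _ fun k _ ↦
      aemeasurable_En hlaw (((hY k).sub_const 1).pow_const 2) n)

variable {PX : Measure 𝒳} [IsProbabilityMeasure PX]
  {μ : Kernel 𝒳 (Slate d)} [IsMarkovKernel μ] {ρ : Kernel (𝒳 × Slate d) ℝ} [IsMarkovKernel ρ]
  [∀ k, IsMarkovKernel (μs k)] [IsMarkovKernel π]

theorem V_eq (hfact : IsFactored PX μ μs) (hcov : Covers PX π μs)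
    (hY : ∀ k, MemLp (Y π μs k) 2 (dataLaw PX μ ρ)) (hGR : MemLp (GR π μs) 2 (dataLaw PX μ ρ))
    (β : ℝ) :
    V π μs (dataLaw PX μ ρ) β = variance (GR π μs) (dataLaw PX μ ρ)
      - 2 * β * ∫ z, GR π μs z * (G π μs z - 1) ∂(dataLaw PX μ ρ)
      + β ^ 2 * ∑ k, ∫ z, (Y π μs k z - 1) ^ 2 ∂(dataLaw PX μ ρ) := by
  have hG := memLp_G_sub_one hY
  have hG0 := integral_G_sub_one hfact hcov hY
  have hcovar : cov[GR π μs, fun z ↦ G π μs z - 1; dataLaw PX μ ρ]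
      = ∫ z, GR π μs z * (G π μs z - 1) ∂(dataLaw PX μ ρ) := by
    rw [covariance_eq_sub hGR hG, hG0, mul_zero, sub_zero]
    rfl
  have hvar : variance (fun z ↦ G π μs z - 1) (dataLaw PX μ ρ)
      = ∑ k, ∫ z, (Y π μs k z - 1) ^ 2 ∂(dataLaw PX μ ρ) := by
    rw [← integral_G_sub_one_sq hfact hcov hY,
      variance_of_integral_eq_zero hG.aestronglyMeasurable.aemeasurable hG0]
  have h := variance_fun_sub hGR (hG.const_mul β)
  rw [covariance_const_mul_right, variance_const_mul, hcovar, hvar] at h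
  unfold V Gam
  rw [h]
  ring

/-- The population weight minimises the variance. -/
theorem Vdagger_eq (hfact : IsFactored PX μ μs) (hcov : Covers PX π μs)
    (hY : ∀ k, MemLp (Y π μs k) 2 (dataLaw PX μ ρ)) (hGR : MemLp (GR π μs) 2 (dataLaw PX μ ρ)) :
    Vdagger π μs (dataLaw PX μ ρ)
      = V π μs (dataLaw PX μ ρ) (betaStar π μs (dataLaw PX μ ρ)) := by
  refine le_antisymm (ciInf_le ⟨0, ?_⟩ _) (le_ciInf fun β ↦ ?_)
  · rintro _ ⟨β, rfl⟩
    exact variance_nonneg _ _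
  simp only [V_eq hfact hcov hY hGR, betaStar]
  set N := ∫ z, GR π μs z * (G π μs z - 1) ∂(dataLaw PX μ ρ) with hN
  set S := ∑ k, ∫ z, (Y π μs k z - 1) ^ 2 ∂(dataLaw PX μ ρ) with hS
  -- If `S = 0`, then `G = 1` almost surely and `V_β` is constant in `β`.
  by_cases h0 : S = 0
  · have hN0 : N = 0 := by
      refine integral_eq_zero_of_ae ?_
      filter_upwards [ae_Y_eq_one hY h0] with z hz
      simp [G_sub_one, hz]
    simp [h0, hN0]
  · have hpos : 0 < S := lt_of_le_of_ne
      (Finset.sum_nonneg fun k _ ↦ integral_nonneg fun z ↦ sq_nonneg _) (Ne.symm h0)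
    -- Completing the square: this is the excess of `V_β` over its value at `N / S`.
    have hsq : 0 ≤ S * (β - N / S) ^ 2 := by positivity
    have hc : N / S * S = N := div_mul_cancel₀ N h0
    have hNS : N = N / S * S := hc.symm
    generalize N / S = b at *
    rw [hNS]
    nlinarith [hsq]

end Weight

end SlateOPE

theorem lemma6 {𝒳 : Type*} [MeasurableSpace 𝒳] {K : ℕ} {d : Fin K → ℕ}
    (PX : Measure 𝒳) [IsProbabilityMeasure PX]
    (μ : Kernel 𝒳 (SlateOPE.Slate d)) [IsMarkovKernel μ]
    (μs : (k : Fin K) → Kernel 𝒳 (Fin (d k))) [∀ k, IsMarkovKernel (μs k)]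
    (π : Kernel 𝒳 (SlateOPE.Slate d)) [IsMarkovKernel π]
    (ρ : Kernel (𝒳 × SlateOPE.Slate d) ℝ) [IsMarkovKernel ρ]
    (hfact : SlateOPE.IsFactored PX μ μs)
    (hcov : SlateOPE.Covers PX π μs)
    (hY : ∀ k, MemLp (SlateOPE.Y π μs k) 2 (SlateOPE.dataLaw PX μ ρ))
    (hGR : MemLp (SlateOPE.GR π μs) 2 (SlateOPE.dataLaw PX μ ρ))
    {Ω : Type*} [MeasurableSpace Ω] (P : Measure Ω) [IsProbabilityMeasure P]
    (Z : ℕ → Ω → SlateOPE.Obs 𝒳 d)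
    (hlaw : ∀ i, HasLaw (Z i) (SlateOPE.dataLaw PX μ ρ) P)
    (hindep : iIndepFun Z P) :
    TendstoInDistribution
      (fun (n : ℕ) (ω : Ω) ↦
        √(n : ℝ) * (SlateOPE.thetaHat π μs (fun i ↦ Z i ω) n
            (SlateOPE.betaHat π μs (fun i ↦ Z i ω) n)
          - SlateOPE.theta π μs (SlateOPE.dataLaw PX μ ρ)))
      atTop (id : ℝ → ℝ) (fun _ ↦ P)
      (gaussianReal 0 (SlateOPE.Vdagger π μs (SlateOPE.dataLaw PX μ ρ)).toNNReal) := by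
  have hG := SlateOPE.memLp_G_sub_one hY
  rw [SlateOPE.Vdagger_eq hfact hcov hY hGR]
  exact SlateOPE.tendstoInDistribution_controlVariate hlaw hindep hGR hG
    (SlateOPE.integral_G_sub_one hfact hcov hY)
    (SlateOPE.aemeasurable_betaHat (fun k ↦ (hY k).aemeasurable) hGR.aemeasurable hG.aemeasurable
      hlaw)
    (SlateOPE.ae_tendsto_betaHat hY hGR hG hlaw hindep)
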